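/- Let $V$ be a finite set and let $\mathcal P=(P_t)_{t\ge 1}$ be a sequence of transition matrices on $V$ (nonnegative entries, each row summing to $1$). Suppose that each $P_t$ is irreducible (for all $u,v\in V$ there is $k>0$ with $P_t^k(u,v)>0$) and lazy ($P_t(v,v)\ge 1/2$ for all $v\in V$), and that there is one probability vector $\pi$ on $V$ which is stationary for every $P_t$ ($\pi P_t=\pi$) and with respect to which every $P_t$ is reversible ($\pi(u)P_t(u,v)=\pi(v)P_t(v,u)$ for all $u,v\in V$). Suppose also that $$t_{\mathrm{HIT}}(\mathcal P)=\sup_{t\ge 1}t_{\mathrm{hit}}(P_t)<\infty,$$ where $t_{\mathrm{hit}}(P)=\max_{u,w\in V}\mathbb E\left[\min\{s\ge 0:X_s=w\}\mid X_0=u\right]$ for the random walk $(X_s)_{s\ge0}$ with transition matrix $P$. Let $\Sigma$ be a finite set of opinions, and consider pull voting according to $\mathcal P$: initially each vertex holds a given opinion in $\Sigma$, and in round $t=1,2,\dots$ every vertex $u$, independently of the other vertices and of the past, chooses a vertex according to the distribution $P_t(u,\cdot)$, and all vertices simultaneously replace their opinion by the opinion that their chosen vertex held before the round. Then, for every $\sigma\in\Sigma$,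 the process finally agrees on $\sigma$ (that is, from some round on all vertices hold $\sigma$) with probability $$\sum_{v\in V_\sigma}\pi(v),$$ where $V_\sigma$ is the set of vertices initially holding $\sigma$. -/

import Mathlib

open MeasureTheory ProbabilityTheory Filter
open scoped ENNReal

noncomputable section

namespace PullVoting

/-- Transition matrices on the finite vertex set `V`: nonnegative real entries, rows summing to `1`. -/
abbrev TransitionMatrix (V : Type*) [Fintype V] [DecidableEq V] : Type _ :=
  Matrix.rowStochastic ℝ V

section Matrices

variable {V : Type*} [Fintype V] [DecidableEq V]

/-- `P` is lazy: every vertex stays put with probability at least `1/2`. -/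
def IsLazy (P : TransitionMatrix V) : Prop := ∀ v, 1 / 2 ≤ P.1 v v

/-- `P` is reversible with respect to `π` (detailed balance). -/
def IsReversible (P : TransitionMatrix V) (π : V → ℝ) : Prop :=
  ∀ u v, π u * P.1 u v = π v * P.1 v u

/-- `π` is a stationary distribution of `P`: a probability vector with `π P = π`. -/
def IsStationary (P : TransitionMatrix V) (π : V → ℝ) : Prop :=
  π ∈ stdSimplex ℝ V ∧ Matrix.vecMul π P.1 = π

/-! ### Random walks and hitting times -/

/-- The probability distribution `P(u, ·)` on `V`. -/
def row (P : TransitionMatrix V) (u : V) : PMF V :=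
  PMF.ofFintype (fun v => ENNReal.ofReal (P.1 u v)) (by
    rw [← ENNReal.ofReal_sum_of_nonneg (fun v _ => P.2.1 u v),
      Matrix.sum_row_of_mem_rowStochastic P.2 u, ENNReal.ofReal_one])

/-- The transition kernel of the random walk according to `(P_t)_{t ≥ 1}` from time `t` to time
`t + 1`: given the trajectory `x_0, …, x_t`, the next position has distribution
`P_{t+1}(x_t, ·)`. -/
def walkKernel [MeasurableSpace V] [MeasurableSingletonClass V]
    (P : ℕ → TransitionMatrix V) (t : ℕ) :
    Kernel ((i : Finset.Iic t) → (fun _ : ℕ => V) i) V :=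
  Kernel.ofFunOfCountable fun x => (row (P (t + 1)) (x ⟨t, by simp⟩)).toMeasure

instance [MeasurableSpace V] [MeasurableSingletonClass V] (P : ℕ → TransitionMatrix V) (t : ℕ) :
    IsMarkovKernel (walkKernel P t) :=
  ⟨fun x => by
    change IsProbabilityMeasure (row (P (t + 1)) (x ⟨t, by simp⟩)).toMeasure
    infer_instance⟩

/-- The law on trajectories `ℕ → V` of the random walk according to `(P_t)_{t ≥ 1}` started
from `u` at time `0`. -/
def walkLaw [MeasurableSpace V] [MeasurableSingletonClass V]
    (P : ℕ → TransitionMatrix V) (u : V) : Measure (ℕ → V) :=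
  Kernel.traj (X := fun _ : ℕ => V) (walkKernel P) 0 (fun _ => u)

/-- `min {t ≥ 0 : x_t = w}`, which is `∞` if the trajectory `x` never visits `w`. -/
def hitTime (w : V) (x : ℕ → V) : ℝ≥0∞ := ⨅ (t : ℕ) (_ : x t = w), (t : ℝ≥0∞)

/-- The hitting time `t_hit` of a sequence of transition matrices: the worst-case expectation,
over the start `u` and the target `w`, of the time at which the random walk first visits `w`. -/
def tHit (P : ℕ → TransitionMatrix V) : ℝ≥0∞ :=
  letI : MeasurableSpace V := ⊤
  ⨆ (u : V) (w : V), ∫⁻ x, hitTime w x ∂(walkLaw P u)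

/-- `t_HIT = max_{t ≥ 1} t_hit(P_t)`: the worst hitting time among the static chains `P_t`. -/
def tHIT (P : ℕ → TransitionMatrix V) : ℝ≥0∞ :=
  ⨆ (t : ℕ) (_ : 1 ≤ t), tHit (fun _ => P t)

end Matrices

/-! ### Pull voting -/

section Voting

variable {V : Type*} [Fintype V] [DecidableEq V] {S : Type*} [DecidableEq S]

/-- The probability that one round of pull voting according to `P` turns the opinions `y` into
`y'`. Every vertex `u` independently chooses a vertex `c u` with distribution `P(u, ·)` and adopts
the opinion `y (c u)`; the sum runs over the joint choices `c` that lead to `y'`. -/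
def pullProb (P : TransitionMatrix V) (y y' : V → S) : ℝ :=
  ∑ c : V → V with (fun u => y (c u)) = y', ∏ u, P.1 u (c u)

/-- `Y` is a pull voting process according to `(P_t)_{t ≥ 1}` with initial opinions `y₀`, on the
probability space `(Ω, μ)`: the `t`-th round is a round of pull voting according to `P_t`,
independent of the earlier rounds, that is, conditionally on
`Y_0 = y_0, …, Y_t = y_t` (whenever this has positive probability), the probability of
`Y_{t+1} = y_{t+1}` is `pullProb P_{t+1} y_t y_{t+1}`. -/
structure IsPullVoting {Ω : Type*} [MeasurableSpace Ω] (μ : Measure Ω)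
    (P : ℕ → TransitionMatrix V) (y₀ : V → S) (Y : ℕ → Ω → V → S) : Prop where
  measurable : ∀ (t : ℕ) (y : V → S), MeasurableSet {ω | Y t ω = y}
  initial : ∀ᵐ ω ∂μ, Y 0 ω = y₀
  step : ∀ (t : ℕ) (y : ℕ → V → S),
    μ {ω | ∀ s ≤ t + 1, Y s ω = y s} =
      μ {ω | ∀ s ≤ t, Y s ω = y s} * ENNReal.ofReal (pullProb (P (t + 1)) (y t) (y (t + 1)))

end Voting

end PullVoting

end

/-! The `π`-mass `M_t` of the vertices holding `σ` has constant mean by stationarity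
(`sum_pullProb_mass`). It is `1` at consensus on `σ` and `0` when nobody holds `σ`, so the claim
follows once mixed states become improbable.

For that, consider `E[M_t ^ 2] ≤ 1`. Since the vertices choose independently, a round raises it by
the mean of `∑ π(v)^2 a_v (1 - a_v)`, where `a_v` is the probability that `v` adopts `σ`
(`sum_choice_sq`). In a mixed state this increment is at least a constant `δ > 0`
(`le_sum_pullProb_mass_sq`): laziness bounds `a_u` below at a holder `u` of `σ`, and the finite
hitting times bound `1 - a_u` below at some such `u`, uniformly in `t` (`exists_pos_le_exit`). Hence
the probabilities of mixed states are summable and tend to `0`.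

Consensus is absorbing, so eventual consensus has the limiting probability of consensus at time `t`
(`tendsto_consensus`). -/

namespace PullVoting

/-! ### Hitting times and conductance -/

section HittingTime

variable {V : Type*} [Fintype V] [DecidableEq V]

lemma row_toMeasure_finset [MeasurableSpace V] [MeasurableSingletonClass V]
    (P : TransitionMatrix V) (u : V) (A : Finset V) :
    (row P u).toMeasure A = ENNReal.ofReal (∑ x ∈ A, P.1 u x) := by
  rw [PMF.toMeasure_apply_finset, ENNReal.ofReal_sum_of_nonneg fun x _ => P.2.1 u x]
  rfl

instance [MeasurableSpace V] [MeasurableSingletonClass V] (P : ℕ → TransitionMatrix V) (u : V) :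
    IsProbabilityMeasure (walkLaw P u) := by
  unfold walkLaw; infer_instance

/-- Conditionally on the trajectory up to time `n`, the next step has law `P (n + 1)` from the
current vertex; integrating the bound over trajectories gives the claim. -/
lemma walkLaw_exit_le [MeasurableSpace V] [MeasurableSingletonClass V]
    (P : ℕ → TransitionMatrix V) (u : V) (A : Finset V) (n : ℕ) (ε : ℝ)
    (h : ∀ a ∈ A, ∑ x ∈ Aᶜ, (P (n + 1)).1 a x ≤ ε) :
    walkLaw P u {x | x n ∈ A ∧ x (n + 1) ∉ A} ≤ ENNReal.ofReal ε := by
  have key := Kernel.partialTraj_compProd_eq_map_traj (X := fun _ : ℕ => V) (κ := walkKernel P)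
    (Nat.zero_le n) (x₀ := fun _ => u)
  let T : Set (((i : Finset.Iic n) → V) × V) := {z | z.1 ⟨n, by simp⟩ ∈ A ∧ z.2 ∉ A}
  have hA : MeasurableSet (A : Set V) := A.measurableSet
  have hT : MeasurableSet T := by
    have h1 : Measurable fun z : ((i : Finset.Iic n) → V) × V => z.1 ⟨n, by simp⟩ := by fun_prop
    exact (h1 hA).inter (measurable_snd hA.compl)
  have e : walkLaw P u {x | x n ∈ A ∧ x (n + 1) ∉ A} =
      ((Kernel.traj (X := fun _ : ℕ => V) (walkKernel P) 0 (fun _ => u)).map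
        (fun x => (Preorder.frestrictLe n x, x (n + 1)))) T := by
    rw [Measure.map_apply (by fun_prop) hT]; rfl
  rw [e, ← key, Measure.compProd_apply hT]
  calc _ ≤ ∫⁻ _, ENNReal.ofReal ε ∂(Kernel.partialTraj (X := fun _ : ℕ => V) (walkKernel P) 0 n
              (fun _ => u)) := by
        refine lintegral_mono fun z => ?_
        change (row (P (n + 1)) (z ⟨n, by simp⟩)).toMeasure _ ≤ _
        by_cases hz : z ⟨n, by simp⟩ ∈ A
        · have : (Prod.mk z ⁻¹' T) = ((Aᶜ : Finset V) : Set V) := by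
            ext v; simp [T, hz]
          rw [this, row_toMeasure_finset]
          exact ENNReal.ofReal_le_ofReal (h _ hz)
        · have : (Prod.mk z ⁻¹' T) = ∅ := by
            ext v; simp [T, hz]
          simp [this]
    _ = ENNReal.ofReal ε := by simp

lemma walkLaw_start [MeasurableSpace V] [MeasurableSingletonClass V]
    (P : ℕ → TransitionMatrix V) (u : V) : walkLaw P u {x | x 0 ≠ u} = 0 := by
  have key := Kernel.traj_map_frestrictLe_apply (X := fun _ : ℕ => V) (κ := walkKernel P) 0 0
    (fun _ => u)
  let T : Set ((i : Finset.Iic 0) → V) := {z | z ⟨0, by simp⟩ ≠ u}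
  have hT : MeasurableSet T := by
    have h1 : Measurable fun z : (i : Finset.Iic 0) → V => z ⟨0, by simp⟩ := by fun_prop
    exact h1 (measurableSet_singleton u).compl
  have e : walkLaw P u {x | x 0 ≠ u} =
      ((Kernel.traj (X := fun _ : ℕ => V) (walkKernel P) 0 (fun _ => u)).map
        (Preorder.frestrictLe 0)) T := by
    rw [Measure.map_apply (by fun_prop) hT]; rfl
  rw [e, key, Kernel.partialTraj_self, Kernel.id_apply, Measure.dirac_apply' _ hT]
  simp [T]

/-- If each step leaves `A` with probability at most `ε`, then the walk from `u ∈ A` needs long to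
reach a vertex outside `A`. -/
lemma le_lintegral_hitTime [MeasurableSpace V] [MeasurableSingletonClass V]
    (P : ℕ → TransitionMatrix V) (A : Finset V) (n : ℕ) (ε : ℝ)
    (h : ∀ k, ∀ a ∈ A, ∑ x ∈ Aᶜ, (P (k + 1)).1 a x ≤ ε) {u w : V} (hu : u ∈ A) (hw : w ∉ A) :
    ((n + 1 : ℕ) : ℝ≥0∞) * (1 - n * ENNReal.ofReal ε) ≤ ∫⁻ x, hitTime w x ∂walkLaw P u := by
  set G : Set (ℕ → V) := {x | ∀ k ≤ n, x k ∈ A}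
  have hm (k : ℕ) : MeasurableSet {x : ℕ → V | x k ∈ A} :=
    measurable_pi_apply (X := fun _ : ℕ => V) k A.measurableSet
  have hG : MeasurableSet G := by
    have : G = ⋂ k, ⋂ (_ : k ≤ n), {x : ℕ → V | x k ∈ A} := by ext; simp [G]
    rw [this]
    exact .iInter fun k => .iInter fun _ => hm k
  -- A walk started at `u ∈ A` that is outside `A` by time `n` makes an exit step before then; a
  -- union bound over the `n` steps follows.
  have hGc : Gᶜ ⊆ {x | x 0 ≠ u} ∪ ⋃ k ∈ Finset.range n, {x | x k ∈ A ∧ x (k + 1) ∉ A} := by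
    intro x hx
    by_contra hc
    simp only [ne_eq, Set.mem_union, Set.mem_ofPred_eq, Set.mem_iUnion, Finset.mem_range,
      not_or, not_not, not_exists, not_and] at hc
    refine hx fun k hk => ?_
    induction k with
    | zero => rw [hc.1]; exact hu
    | succ k ih => exact hc.2 k hk (ih (by omega))
  have hle : walkLaw P u Gᶜ ≤ n * ENNReal.ofReal ε := by
    refine (measure_mono hGc).trans ((measure_union_le _ _).trans ?_)
    rw [walkLaw_start, zero_add]
    refine (measure_biUnion_finset_le _ _).trans ?_
    refine (Finset.sum_le_sum fun k _ => walkLaw_exit_le P u A k ε (h k)).trans ?_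
    simp
  have hge : 1 - n * ENNReal.ofReal ε ≤ walkLaw P u G := by
    rw [tsub_le_iff_right, ← prob_add_prob_compl (μ := walkLaw P u) hG]
    gcongr
  calc _ ≤ ((n + 1 : ℕ) : ℝ≥0∞) * walkLaw P u G := by gcongr
    _ = ∫⁻ x, G.indicator (fun _ => ((n + 1 : ℕ) : ℝ≥0∞)) x ∂walkLaw P u := by
      rw [lintegral_indicator hG, setLIntegral_const]
    _ ≤ _ := by
      refine lintegral_mono fun x => Set.indicator_le (fun x hx => ?_) x
      -- On `G` the walk stays in `A` through time `n`, so `w ∉ A` is hit at time `n + 1` at the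
      -- earliest.
      refine le_iInf fun t => le_iInf fun ht => ?_
      rcases Nat.lt_or_ge n t with hlt | hge
      · exact_mod_cast hlt
      · exact absurd (ht ▸ hx t hge) hw

/-- A finite bound on the hitting times gives a uniform lower bound on the conductance. -/
lemma exists_pos_le_exit (P : ℕ → TransitionMatrix V) (hfin : tHIT P < ∞) :
    ∃ ε : ℝ, 0 < ε ∧ ∀ t, 1 ≤ t → ∀ A : Finset V, A.Nonempty → Aᶜ.Nonempty →
      ∃ u ∈ A, ε ≤ ∑ x ∈ Aᶜ, (P t).1 u x := by
  obtain ⟨n, hn⟩ := ENNReal.exists_nat_gt (ENNReal.mul_ne_top ENNReal.ofNat_ne_top hfin.ne :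
    2 * tHIT P ≠ ∞)
  have hn0 : 0 < n := by
    rcases Nat.eq_zero_or_pos n with rfl | h
    · simp at hn
    · exact h
  have hn0' : (0 : ℝ) < n := by exact_mod_cast hn0
  -- With this `ε` the walk stays in `A` for `n` steps with probability at least `1/2`, forcing `(n
  -- + 1) / 2 ≤ tHIT P` against `2 * tHIT P < n`.
  refine ⟨1 / (2 * n), by positivity, fun t ht A ⟨u, hu⟩ ⟨w, hw⟩ => ?_⟩
  by_contra! hc
  let : MeasurableSpace V := ⊤
  have h1 := le_lintegral_hitTime (fun _ => P t) A n (1 / (2 * n)) (fun _ a ha => (hc a ha).le) hu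
    (Finset.mem_compl.1 hw)
  have h2 : ∫⁻ x, hitTime w x ∂walkLaw (fun _ => P t) u ≤ tHIT P :=
    (le_iSup₂ (f := fun u w : V => ∫⁻ x, hitTime w x ∂walkLaw (fun _ => P t) u) u w).trans
      (le_iSup₂ (f := fun (t : ℕ) (_ : 1 ≤ t) => tHit fun _ => P t) t ht)
  have h3 : (n : ℝ≥0∞) * ENNReal.ofReal (1 / (2 * n)) = 2⁻¹ := by
    rw [← ENNReal.ofReal_natCast, ← ENNReal.ofReal_mul (by positivity)]
    rw [show (n : ℝ) * (1 / (2 * n)) = 2⁻¹ by field_simp, ENNReal.ofReal_inv_of_pos two_pos]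
    simp
  rw [h3, ENNReal.one_sub_inv_two] at h1
  have h4 : ((n + 1 : ℕ) : ℝ≥0∞) ≤ 2 * tHIT P := by
    have := mul_le_mul_right (h1.trans h2) 2
    rwa [mul_left_comm, ENNReal.mul_inv_cancel two_ne_zero ENNReal.ofNat_ne_top, mul_one] at this
  have h5 := h4.trans_lt hn
  norm_cast at h5
  omega

end HittingTime

/-! ### Moments of one round of independent choices -/

section Moments

variable {V : Type*} [Fintype V] [DecidableEq V]

lemma row_sum (P : TransitionMatrix V) (u : V) : ∑ x, P.1 u x = 1 :=
  Matrix.sum_row_of_mem_rowStochastic P.2 u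

/-- Independence of the choices: expectations of products over the vertices factor. -/
lemma sum_choice_prod (P : TransitionMatrix V) (g : V → V → ℝ) :
    ∑ c : V → V, (∏ u, P.1 u (c u)) * ∏ u, g u (c u) = ∏ u, ∑ x, P.1 u x * g u x := by
  simp_rw [← Finset.prod_mul_distrib]
  rw [Finset.prod_univ_sum, Fintype.piFinset_univ]

lemma sum_choice_apply (P : TransitionMatrix V) (v : V) (h : V → ℝ) :
    ∑ c : V → V, (∏ u, P.1 u (c u)) * h (c v) = ∑ x, P.1 v x * h x := by
  have := sum_choice_prod P fun u x => if u = v then h x else 1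
  simp only [Finset.prod_ite_eq', Finset.mem_univ, if_true] at this
  rw [this, Finset.prod_eq_single v]
  · simp
  · intro b _ hb; simp [hb, row_sum]
  · simp

lemma sum_choice_apply_mul (P : TransitionMatrix V) {v w : V} (hvw : v ≠ w) (h k : V → ℝ) :
    ∑ c : V → V, (∏ u, P.1 u (c u)) * (h (c v) * k (c w)) =
      (∑ x, P.1 v x * h x) * ∑ x, P.1 w x * k x := by
  have := sum_choice_prod P fun u x => (if u = v then h x else 1) * (if u = w then k x else 1)
  simp only [Finset.prod_mul_distrib, Finset.prod_ite_eq', Finset.mem_univ, if_true] at this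
  rw [this, Finset.prod_eq_mul v w hvw]
  · simp [hvw, hvw.symm]
  · intro b _ hb; simp [hb.1, hb.2, row_sum]
  · simp
  · simp

/-- The first moment of a weighted sum over the chosen vertices. -/
lemma sum_choice_linear {P : TransitionMatrix V} {π : V → ℝ} (hπ : IsStationary P π)
    (f : V → ℝ) :
    ∑ c : V → V, (∏ u, P.1 u (c u)) * ∑ v, π v * f (c v) = ∑ v, π v * f v := by
  simp_rw [Finset.mul_sum]
  rw [Finset.sum_comm]
  have (v : V) : ∑ c : V → V, (∏ u, P.1 u (c u)) * (π v * f (c v)) =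
      ∑ x, π v * P.1 v x * f x := by
    rw [sum_choice_apply P v fun x => π v * f x]
    exact Finset.sum_congr rfl fun x _ => by ring
  simp_rw [this]
  rw [Finset.sum_comm]
  refine Finset.sum_congr rfl fun x _ => ?_
  rw [← Finset.sum_mul]
  congr 1
  exact congrFun hπ.2 x

/-- The second moment of a weighted sum of `0`-`1`-values over the chosen vertices. -/
lemma sum_choice_sq {P : TransitionMatrix V} {π : V → ℝ} (hπ : IsStationary P π)
    (f : V → ℝ) (hf : ∀ v, f v * f v = f v) :
    ∑ c : V → V, (∏ u, P.1 u (c u)) * (∑ v, π v * f (c v)) ^ 2 =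
      (∑ v, π v * f v) ^ 2 +
        ∑ v, π v ^ 2 * ((∑ x, P.1 v x * f x) * (1 - ∑ x, P.1 v x * f x)) := by
  set a : V → ℝ := fun v => ∑ x, P.1 v x * f x with ha
  have hmean : ∑ v, π v * f v = ∑ v, π v * a v := by
    rw [← sum_choice_linear hπ f]
    simp_rw [Finset.mul_sum]
    rw [Finset.sum_comm]
    refine Finset.sum_congr rfl fun v _ => ?_
    rw [sum_choice_apply P v fun x => π v * f x]
    rw [ha, Finset.mul_sum]
    exact Finset.sum_congr rfl fun x _ => by ring
  -- Distinct vertices are uncorrelated; on the diagonal `f ^ 2 = f` leaves the Bernoulli variance.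
  have hpair (v w : V) : ∑ c : V → V, (∏ u, P.1 u (c u)) * (π v * f (c v) * (π w * f (c w))) =
      π v * a v * (π w * a w) + if v = w then π v ^ 2 * (a v * (1 - a v)) else 0 := by
    split_ifs with h
    · subst h
      have : ∀ c : V → V, (∏ u, P.1 u (c u)) * (π v * f (c v) * (π v * f (c v))) =
          (∏ u, P.1 u (c u)) * (fun x => π v ^ 2 * f x) (c v) := fun c => by
        dsimp only
        linear_combination ((∏ u, P.1 u (c u)) * π v ^ 2) * hf (c v)
      simp_rw [this]
      rw [sum_choice_apply P v fun x => π v ^ 2 * f x]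
      have : ∑ x, P.1 v x * (π v ^ 2 * f x) = π v ^ 2 * a v := by
        rw [ha, Finset.mul_sum]
        exact Finset.sum_congr rfl fun x _ => by ring
      rw [this]
      ring
    · rw [sum_choice_apply_mul P h (fun x => π v * f x) fun x => π w * f x, add_zero]
      simp_rw [ha, Finset.mul_sum, mul_left_comm]
  simp_rw [sq (∑ v, π v * f _), Finset.sum_mul_sum, Finset.mul_sum]
  rw [Finset.sum_comm]
  simp_rw [Finset.sum_comm (s := (Finset.univ : Finset (V → V))), hpair]
  simp only [Finset.sum_add_distrib, Finset.sum_ite_eq, Finset.mem_univ, if_true]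
  rw [← Finset.sum_mul_sum, ← Finset.sum_mul_sum, hmean]

/-- Some vertex has positive mass, and `π = π P^k` carries part of it to `v` for a suitable `k`. -/
lemma IsStationary.pos {P : TransitionMatrix V} {π : V → ℝ} (hπ : IsStationary P π)
    (hP : P.1.IsIrreducible) (v : V) : 0 < π v := by
  have hpow (k : ℕ) : Matrix.vecMul π (P.1 ^ k) = π := by
    induction k with
    | zero => simp
    | succ k ih => rw [pow_succ, ← Matrix.vecMul_vecMul, ih, hπ.2]
  obtain ⟨u, hu⟩ : ∃ u, 0 < π u := by
    by_contra! h
    have := Finset.sum_nonpos fun u (_ : u ∈ Finset.univ) => h u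
    rw [hπ.1.2] at this
    linarith
  obtain ⟨k, -, hk⟩ := (Matrix.isIrreducible_iff_exists_pow_pos P.2.1).1 hP u v
  have hnn : ∀ i j, 0 ≤ (P.1 ^ k) i j := (pow_mem P.2 k).1
  rw [← hpow k]
  refine (mul_pos hu hk).trans_le ?_
  exact Finset.single_le_sum (f := fun i => π i * (P.1 ^ k) i v)
    (fun i _ => mul_nonneg (hπ.1.1 i) (hnn i v)) (Finset.mem_univ u)

end Moments

/-! ### Evolution of the law of the opinions -/

section Law

variable {V : Type*} [Fintype V] [DecidableEq V] {S : Type*} [DecidableEq S]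

lemma pullProb_nonneg (P : TransitionMatrix V) (y y' : V → S) : 0 ≤ pullProb P y y' :=
  Finset.sum_nonneg fun _ _ => Finset.prod_nonneg fun u _ => P.2.1 u _

lemma sum_pullProb_mul [Fintype S] (P : TransitionMatrix V) (y : V → S) (F : (V → S) → ℝ) :
    ∑ y', pullProb P y y' * F y' =
      ∑ c : V → V, (∏ u, P.1 u (c u)) * F fun u => y (c u) := by
  simp_rw [pullProb, Finset.sum_filter, Finset.sum_mul]
  rw [Finset.sum_comm]
  refine Finset.sum_congr rfl fun c _ => ?_
  simp [ite_mul]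

/-- The `π`-mass of the vertices holding `σ`. -/
def mass (π : V → ℝ) (σ : S) (y : V → S) : ℝ := ∑ v, π v * if y v = σ then 1 else 0

/-- Some vertices hold `σ` and some do not. -/
def IsMixed (σ : S) (y : V → S) : Prop := (∃ v, y v = σ) ∧ ∃ v, y v ≠ σ

lemma mass_nonneg {π : V → ℝ} (hπ : ∀ v, 0 ≤ π v) (σ : S) (y : V → S) : 0 ≤ mass π σ y :=
  Finset.sum_nonneg fun v _ => mul_nonneg (hπ v) (by split_ifs <;> simp)

lemma mass_le_one {π : V → ℝ} (hπ : π ∈ stdSimplex ℝ V) (σ : S) (y : V → S) :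
    mass π σ y ≤ 1 := by
  rw [← hπ.2]
  exact Finset.sum_le_sum fun v _ => mul_le_of_le_one_right (hπ.1 v) (by split_ifs <;> simp)

lemma sum_pullProb_mass [Fintype S] {P : TransitionMatrix V} {π : V → ℝ}
    (hπ : IsStationary P π) (σ : S) (y : V → S) :
    ∑ y', pullProb P y y' * mass π σ y' = mass π σ y := by
  rw [sum_pullProb_mul]
  exact sum_choice_linear hπ fun x => if y x = σ then 1 else 0

-- The variance gain of one round. A single vertex `u` suffices: it holds `σ`, so laziness gives
-- `a_u ≥ 1/2`, and it chooses a vertex not holding `σ` with probability at least `ε`.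
open Classical in
lemma le_sum_pullProb_mass_sq [Fintype S] {P : TransitionMatrix V} {π : V → ℝ}
    (hπ : IsStationary P π) (hlazy : IsLazy P) {m ε : ℝ} (hm0 : 0 ≤ m) (hm : ∀ v, m ≤ π v)
    (hε : 0 ≤ ε)
    (hexit : ∀ A : Finset V, A.Nonempty → Aᶜ.Nonempty → ∃ u ∈ A, ε ≤ ∑ x ∈ Aᶜ, P.1 u x)
    (σ : S) (y : V → S) :
    mass π σ y ^ 2 + (if IsMixed σ y then m ^ 2 * (1 / 2 * ε) else 0) ≤
      ∑ y', pullProb P y y' * mass π σ y' ^ 2 := by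
  rw [sum_pullProb_mul]
  set f : V → ℝ := fun x => if y x = σ then 1 else 0 with hf
  have hf0 (x) : 0 ≤ f x := by simp only [hf]; split_ifs <;> simp
  have hf1 (x) : f x ≤ 1 := by simp only [hf]; split_ifs <;> simp
  have hsq := sum_choice_sq hπ f fun v => by simp only [hf]; split_ifs <;> simp
  change _ ≤ ∑ c : V → V, (∏ u, P.1 u (c u)) * (∑ v, π v * f (c v)) ^ 2
  rw [hsq]
  change _ ≤ mass π σ y ^ 2 + _
  have ha0 (v) : 0 ≤ ∑ x, P.1 v x * f x :=
    Finset.sum_nonneg fun x _ => mul_nonneg (P.2.1 v x) (hf0 x)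
  have ha1 (v) : 1 - ∑ x, P.1 v x * f x = ∑ x, P.1 v x * (1 - f x) := by
    simp_rw [mul_sub, mul_one, Finset.sum_sub_distrib, row_sum]
  have ha1' (v) : 0 ≤ 1 - ∑ x, P.1 v x * f x := by
    rw [ha1]
    exact Finset.sum_nonneg fun x _ => mul_nonneg (P.2.1 v x) (sub_nonneg.2 (hf1 x))
  have hterm (v) : 0 ≤ π v ^ 2 * ((∑ x, P.1 v x * f x) * (1 - ∑ x, P.1 v x * f x)) :=
    mul_nonneg (sq_nonneg _) (mul_nonneg (ha0 v) (ha1' v))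
  gcongr
  split_ifs with hmix
  · obtain ⟨⟨v, hv⟩, ⟨w, hw⟩⟩ := hmix
    obtain ⟨u, hu, hle⟩ := hexit (Finset.univ.filter fun x => y x = σ) ⟨v, by simpa using hv⟩
      ⟨w, by simpa using hw⟩
    have huσ : y u = σ := by simpa using hu
    refine le_trans ?_ (Finset.single_le_sum (fun v _ => hterm v) (Finset.mem_univ u))
    have h1 : 1 / 2 ≤ ∑ x, P.1 u x * f x := by
      refine (hlazy u).trans (le_trans ?_ (Finset.single_le_sum
        (fun x _ => mul_nonneg (P.2.1 u x) (hf0 x)) (Finset.mem_univ u)))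
      simp [hf, huσ]
    have h2 : ε ≤ 1 - ∑ x, P.1 u x * f x := by
      rw [ha1]
      refine hle.trans (le_of_eq ?_)
      rw [Finset.compl_filter, Finset.sum_filter]
      refine Finset.sum_congr rfl fun x _ => ?_
      simp only [hf]
      split_ifs <;> simp_all
    have := hm u
    have := ha0 u
    gcongr
  · exact Finset.sum_nonneg fun v _ => hterm v

variable {Ω : Type*} [MeasurableSpace Ω] {μ : Measure Ω}

lemma measure_eq_sum_inter_fiber {ι : Type*} [Fintype ι] (f : Ω → ι)
    (hf : ∀ i, MeasurableSet {ω | f ω = i}) {A : Set Ω} (hA : MeasurableSet A) :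
    μ A = ∑ i, μ (A ∩ {ω | f ω = i}) := by
  have : A = ⋃ i, A ∩ {ω | f ω = i} := by ext; simp
  conv_lhs => rw [this]
  rw [measure_iUnion _ fun i => hA.inter (hf i), tsum_fintype]
  intro i j hij
  refine Set.disjoint_left.2 fun ω h1 h2 => hij ?_
  exact h1.2.symm.trans h2.2

variable {P : ℕ → TransitionMatrix V} {y₀ : V → S} {Y : ℕ → Ω → V → S}

/-- The Markov property for two consecutive rounds. -/
lemma IsPullVoting.measure_inter [Fintype S] (hY : IsPullVoting μ P y₀ Y) (t : ℕ)
    (y y' : V → S) :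
    μ ({ω | Y t ω = y} ∩ {ω | Y (t + 1) ω = y'}) =
      μ {ω | Y t ω = y} * ENNReal.ofReal (pullProb (P (t + 1)) y y') := by
  have hm (h : Fin t → V → S) : MeasurableSet {ω | (fun s : Fin t => Y s ω) = h} := by
    have : {ω | (fun s : Fin t => Y s ω) = h} = ⋂ s : Fin t, {ω | Y s ω = h s} := by
      ext; simp [funext_iff]
    rw [this]
    exact .iInter fun s => hY.measurable s _
  rw [measure_eq_sum_inter_fiber (fun ω (s : Fin t) => Y s ω) hm
      ((hY.measurable t y).inter (hY.measurable (t + 1) y')),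
    measure_eq_sum_inter_fiber (fun ω (s : Fin t) => Y s ω) hm (hY.measurable t y),
    Finset.sum_mul]
  refine Finset.sum_congr rfl fun h _ => ?_
  -- `step` speaks of whole histories, so the law of two consecutive rounds is summed over all pasts
  -- `h`, each glued to `y` and `y'`.
  let z : ℕ → V → S := fun s => if hs : s < t then h ⟨s, hs⟩ else if s = t then y else y'
  have zt : z t = y := by simp [z]
  have zt' : z (t + 1) = y' := by simp [z]
  have zlt (s) (hs : s < t) : z s = h ⟨s, hs⟩ := by simp [z, hs]
  have key := hY.step t z
  rw [zt, zt'] at key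
  convert key using 2
  · ext ω
    simp only [Set.mem_inter_iff, Set.mem_ofPred_eq, funext_iff (f := fun s : Fin t => Y s ω)]
    constructor
    · rintro ⟨⟨h1, h2⟩, h3⟩ s hs
      rcases lt_trichotomy s t with hlt | rfl | hgt
      · rw [zlt s hlt, ← h3 ⟨s, hlt⟩]
      · rw [zt, h1]
      · obtain rfl : s = t + 1 := by omega
        rw [zt', h2]
    · intro H
      refine ⟨⟨?_, ?_⟩, fun s => ?_⟩
      · rw [H t (by omega), zt]
      · rw [H (t + 1) le_rfl, zt']
      · rw [H s (by omega), zlt s s.2]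
  · congr 1
    ext ω
    simp only [Set.mem_inter_iff, Set.mem_ofPred_eq, funext_iff (f := fun s : Fin t => Y s ω)]
    constructor
    · rintro ⟨h1, h3⟩ s hs
      rcases hs.lt_or_eq with hlt | rfl
      · rw [zlt s hlt, ← h3 ⟨s, hlt⟩]
      · rw [zt, h1]
    · intro H
      refine ⟨?_, fun s => ?_⟩
      · rw [H t le_rfl, zt]
      · rw [H s (by omega), zlt s s.2]

lemma IsPullVoting.real_succ [Fintype S] [IsFiniteMeasure μ] (hY : IsPullVoting μ P y₀ Y)
    (t : ℕ) (y' : V → S) :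
    μ.real {ω | Y (t + 1) ω = y'} =
      ∑ y, μ.real {ω | Y t ω = y} * pullProb (P (t + 1)) y y' := by
  rw [Measure.real, measure_eq_sum_inter_fiber (Y t) (hY.measurable t) (hY.measurable (t + 1) y'),
    ENNReal.toReal_sum fun _ _ => measure_ne_top _ _]
  refine Finset.sum_congr rfl fun y _ => ?_
  rw [Set.inter_comm, hY.measure_inter, ENNReal.toReal_mul,
    ENNReal.toReal_ofReal (pullProb_nonneg _ _ _)]
  rfl

lemma IsPullVoting.sum_succ [Fintype S] [IsFiniteMeasure μ] (hY : IsPullVoting μ P y₀ Y)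
    (t : ℕ) (F : (V → S) → ℝ) :
    ∑ y', μ.real {ω | Y (t + 1) ω = y'} * F y' =
      ∑ y, μ.real {ω | Y t ω = y} * ∑ y', pullProb (P (t + 1)) y y' * F y' := by
  simp_rw [hY.real_succ, Finset.sum_mul, Finset.mul_sum]
  rw [Finset.sum_comm]
  simp_rw [mul_assoc]

lemma IsPullVoting.sum_zero [Fintype S] [IsProbabilityMeasure μ] (hY : IsPullVoting μ P y₀ Y)
    (F : (V → S) → ℝ) : ∑ y, μ.real {ω | Y 0 ω = y} * F y = F y₀ := by
  have h1 : μ.real {ω | Y 0 ω = y₀} = 1 := by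
    rw [Measure.real, (prob_compl_eq_zero_iff (hY.measurable 0 y₀)).1 hY.initial]; rfl
  rw [Finset.sum_eq_single y₀, h1, one_mul]
  · intro y _ hy
    have : μ {ω | Y 0 ω = y} = 0 :=
      measure_mono_null (fun ω hω h => hy (hω.symm.trans h)) hY.initial
    simp [Measure.real, this]
  · simp

lemma IsPullVoting.sum_real [Fintype S] [IsProbabilityMeasure μ] (hY : IsPullVoting μ P y₀ Y)
    (t : ℕ) : ∑ y, μ.real {ω | Y t ω = y} = 1 := by
  have := measure_eq_sum_inter_fiber (μ := μ) (Y t) (hY.measurable t) MeasurableSet.univ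
  simp only [Set.univ_inter, measure_univ] at this
  simp_rw [Measure.real]
  rw [← ENNReal.toReal_sum fun _ _ => measure_ne_top _ _, ← this, ENNReal.toReal_one]

lemma IsPullVoting.consensus_succ [Fintype S] (hY : IsPullVoting μ P y₀ Y) (σ : S) (t : ℕ) :
    ∀ᵐ ω ∂μ, Y t ω = (fun _ => σ) → Y (t + 1) ω = fun _ => σ := by
  have h : ∀ y' : V → S, y' ≠ (fun _ => σ) →
      ∀ᵐ ω ∂μ, ¬ (Y t ω = (fun _ => σ) ∧ Y (t + 1) ω = y') := by
    intro y' hy'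
    have h0 : pullProb (P (t + 1)) (fun _ => σ) y' = 0 := by
      simp [pullProb, hy'.symm]
    have := hY.measure_inter t (fun _ => σ) y'
    rw [h0, ENNReal.ofReal_zero, mul_zero] at this
    rw [ae_iff]
    simp only [not_not]
    exact this
  have h' : ∀ᵐ ω ∂μ, ∀ y' : V → S, y' ≠ (fun _ => σ) →
      ¬ (Y t ω = (fun _ => σ) ∧ Y (t + 1) ω = y') :=
    ae_all_iff.2 fun y' => by
      by_cases hy : y' = fun _ => σ
      · simp [hy]
      · filter_upwards [h y' hy] with ω hω _ using hω
  filter_upwards [h'] with ω hω h1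
  by_contra h2
  exact hω _ h2 ⟨h1, rfl⟩

/-- The probability of eventual consensus on `σ` is the limit of the probabilities of consensus. -/
lemma IsPullVoting.tendsto_consensus [Fintype S] (hY : IsPullVoting μ P y₀ Y) (σ : S) :
    Tendsto (fun t => μ {ω | Y t ω = fun _ => σ}) atTop
      (nhds (μ {ω | ∀ᶠ t in atTop, ∀ v, Y t ω v = σ})) := by
  let E : ℕ → Set Ω := fun t => {ω | ∀ s, t ≤ s → Y s ω = fun _ => σ}
  have hE : {ω | ∀ᶠ t in atTop, ∀ v, Y t ω v = σ} = ⋃ t, E t := by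
    ext ω
    simp [E, eventually_atTop, funext_iff]
  have hmono : Monotone E := fun s t hst ω hω r hr => hω r (hst.trans hr)
  rw [hE]
  -- As consensus is almost surely absorbing, `E t` differs from consensus at time `t` by a null
  -- set.
  refine (tendsto_measure_iUnion_atTop hmono).congr fun t => measure_congr ?_
  have hall : ∀ᵐ ω ∂μ, ∀ t, Y t ω = (fun _ => σ) → Y (t + 1) ω = fun _ => σ :=
    ae_all_iff.2 fun t => hY.consensus_succ σ t
  filter_upwards [hall] with ω hω
  refine propext ⟨fun h => h t le_rfl, fun h s hs => ?_⟩
  induction s, hs using Nat.le_induction with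
  | base => exact h
  | succ s _ ih => exact hω s ih

end Law

end PullVoting

/-! ### Convergence to consensus -/

open PullVoting in
/-- The pull voting process finally agrees with `σ` with probability `∑_{v ∈ V_σ} π(v)`, where
`V_σ` is the set of vertices initially holding `σ`. Round `t ≥ 1` uses the matrix `P t`; the
entry `P 0` plays no role. -/
theorem proposition1p10 {V : Type*} [Fintype V] [DecidableEq V]
    {S : Type*} [Fintype S] [DecidableEq S]
    (P : ℕ → PullVoting.TransitionMatrix V) (π : V → ℝ)
    (hirr : ∀ t, 1 ≤ t → (P t).1.IsIrreducible)
    (hlazy : ∀ t, 1 ≤ t → PullVoting.IsLazy (P t))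
    (hrev : ∀ t, 1 ≤ t → PullVoting.IsReversible (P t) π)
    (hstat : ∀ t, 1 ≤ t → PullVoting.IsStationary (P t) π)
    (hfin : PullVoting.tHIT P < ∞)
    (y₀ : V → S)
    {Ω : Type*} [MeasurableSpace Ω] (μ : Measure Ω) [IsProbabilityMeasure μ]
    (Y : ℕ → Ω → V → S) (hY : PullVoting.IsPullVoting μ P y₀ Y) (σ : S) :
    μ {ω | ∀ᶠ t in atTop, ∀ v, Y t ω v = σ} =
      ENNReal.ofReal (∑ v with y₀ v = σ, π v) := by
  classical
  have hst := hstat 1 le_rfl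
  have hpos : ∀ v, 0 < π v := hst.pos (hirr 1 le_rfl)
  obtain ⟨m, hm0, hm⟩ : ∃ m : ℝ, 0 < m ∧ ∀ v, m ≤ π v := by
    cases isEmpty_or_nonempty V
    · exact ⟨1, one_pos, isEmptyElim⟩
    · obtain ⟨v, hv⟩ := Finite.exists_min π
      exact ⟨π v, hpos v, hv⟩
  have hVne : Nonempty V := by
    by_contra h
    rw [not_nonempty_iff] at h
    simpa using hst.1.2
  obtain ⟨ε, hε0, hexit⟩ := exists_pos_le_exit P hfin
  set δ : ℝ := m ^ 2 * (1 / 2 * ε) with hδ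
  have hδ0 : 0 < δ := by positivity
  set q : ℕ → (V → S) → ℝ := fun t y => μ.real {ω | Y t ω = y} with hq
  have hq0 (t y) : 0 ≤ q t y := measureReal_nonneg
  set r : ℕ → ℝ := fun t => ∑ y, q t y * if IsMixed σ y then 1 else 0 with hr
  have hr0 (t) : 0 ≤ r t := Finset.sum_nonneg fun y _ => mul_nonneg (hq0 t y) (by
    split_ifs <;> simp)
  have hmean (t) : ∑ y, q t y * mass π σ y = mass π σ y₀ := by
    induction t with
    | zero => exact hY.sum_zero _
    | succ t ih =>
      rw [hq, hY.sum_succ t, ← ih]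
      simp_rw [sum_pullProb_mass (hstat (t + 1) (by omega))]
      rfl
  have hsq (t) : δ * r t + ∑ y, q t y * mass π σ y ^ 2 ≤ ∑ y, q (t + 1) y * mass π σ y ^ 2 := by
    rw [hq, hY.sum_succ t, hr, Finset.mul_sum, ← Finset.sum_add_distrib]
    refine Finset.sum_le_sum fun y _ => ?_
    have := le_sum_pullProb_mass_sq (hstat (t + 1) (by omega)) (hlazy (t + 1) (by omega)) hm0.le hm
      hε0.le (hexit (t + 1) (by omega)) σ y
    refine le_trans (le_of_eq ?_) (mul_le_mul_of_nonneg_left this (hq0 t y))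
    split_ifs <;> simp only [hδ, hq] <;> ring
  have hbound (t) : ∑ y, q t y * mass π σ y ^ 2 ≤ 1 := by
    rw [← hY.sum_real t]
    refine Finset.sum_le_sum fun y _ => mul_le_of_le_one_right (hq0 t y) ?_
    exact pow_le_one₀ (mass_nonneg hst.1.1 σ y) (mass_le_one hst.1 σ y)
  -- Telescoping `hsq`: each mixed state costs `δ` out of a second moment that never exceeds `1`.
  have hsum (n) : ∑ t ∈ Finset.range n, r t ≤ 1 / δ := by
    have h (n) : δ * ∑ t ∈ Finset.range n, r t ≤ ∑ y, q n y * mass π σ y ^ 2 := by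
      induction n with
      | zero =>
        simp only [Finset.range_zero, Finset.sum_empty, mul_zero]
        exact Finset.sum_nonneg fun y _ => mul_nonneg (hq0 0 y) (sq_nonneg _)
      | succ n ih =>
        rw [Finset.sum_range_succ, mul_add]
        linarith [hsq n]
    rw [le_div_iff₀' hδ0]
    exact (h n).trans (hbound n)
  have hrlim : Tendsto r atTop (nhds 0) :=
    (summable_of_sum_range_le hr0 hsum).tendsto_atTop_zero
  have hmass1 : mass π σ (fun _ : V => σ) = 1 := by simpa [mass] using hst.1.2
  -- Pointwise, the indicator of consensus on `σ` is at most the mass, which is at most that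
  -- indicator plus the indicator of a mixed state.
  have hdiff (t) : q t (fun _ => σ) ≤ mass π σ y₀ ∧
      mass π σ y₀ ≤ q t (fun _ => σ) + r t := by
    have e : q t (fun _ => σ) = ∑ y, q t y * if y = (fun _ => σ) then 1 else 0 := by simp
    rw [e, ← hmean t, hr, ← Finset.sum_add_distrib]
    constructor
    · refine Finset.sum_le_sum fun y _ => mul_le_mul_of_nonneg_left ?_ (hq0 t y)
      split_ifs with h
      · rw [h, hmass1]
      · exact mass_nonneg hst.1.1 σ y
    · refine Finset.sum_le_sum fun y _ => ?_
      rw [← mul_add]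
      refine mul_le_mul_of_nonneg_left ?_ (hq0 t y)
      by_cases hmix : IsMixed σ y
      · rw [if_pos hmix]
        have := mass_le_one hst.1 σ y
        split_ifs <;> linarith
      · rw [if_neg hmix, add_zero]
        split_ifs with h
        · rw [h, hmass1]
        · have hw : ∃ v, y v ≠ σ := by
            by_contra! hc
            exact h (funext hc)
          have : ∀ v, y v ≠ σ := fun v hv => hmix ⟨⟨v, hv⟩, hw⟩
          simp [mass, this]
  have hlim : Tendsto (fun t => q t fun _ => σ) atTop (nhds (mass π σ y₀)) := by
    refine tendsto_of_tendsto_of_tendsto_of_le_of_le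
      (g := fun t => mass π σ y₀ - r t) (h := fun _ => mass π σ y₀) ?_ tendsto_const_nhds
      (fun t => ?_) fun t => (hdiff t).1
    · simpa using tendsto_const_nhds.sub hrlim
    · have := (hdiff t).2
      dsimp only
      linarith
  have hfinal := ENNReal.tendsto_ofReal hlim
  have hmassE : mass π σ y₀ = ∑ v with y₀ v = σ, π v := by
    simp [mass, Finset.sum_filter]
  rw [← hmassE]
  refine tendsto_nhds_unique (hY.tendsto_consensus σ) (hfinal.congr fun t => ?_)
  exact ofReal_measureReal
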